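/- All groups are finite. For a group $G$ let $\Phi(G)$ denote the Frattini subgroup, $F(G)$ the Fitting subgroup (the largest normal nilpotent subgroup), and $\mathrm{Soc}(G)$ the socle (the subgroup generated by the minimal normal subgroups; $\mathrm{Soc}(1)=1$). Let $F^*(G)$ be the quasinilpotent radical, that is, the subgroup with $F(G)\le F^*(G)\le C_G(F(G))F(G)$ and $F^*(G)/F(G)=\mathrm{Soc}\bigl(C_G(F(G))F(G)/F(G)\bigr)$. Let $\tilde F(G)$ be the subgroup with $\Phi(G)\le\tilde F(G)$ and $\tilde F(G)/\Phi(G)=\mathrm{Soc}(G/\Phi(G))$. Put $\tilde F^0(G)=G$ and $\tilde F^n(G)=\tilde F(\tilde F^{n-1}(G))$ for $n\ge 1$. **Proposition 3.2.** Let $G$ be a finite group, let $N$ and $H$ be normal subgroups of $G$, and let $n\ge 0$ be an integer. Then: 1. if $n\ge 1$ and $N\le\Phi(\tilde F^{n-1}(G))$, then $N\le\tilde F^n(G)$ and $\tilde F^n(G/N)=\tilde F^n(G)/N$; 2. $F^*(G)\le\tilde F^n(G)$; 3. if $n\ge 1$ and $\Phi(\tilde F^{n-1}(G))=1$, then $\tilde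 F^n(G)=F^*(G)$; 4. $C_G(\tilde F^n(G))\le F(G)$; 5. $\tilde F^n(N)\le\tilde F^n(G)$; 6. $\tilde F^n(G)N/N\le\tilde F^n(G/N)$; 7. if $G=N\times H$ (internal direct product), then $\tilde F^n(G)=\tilde F^n(H)\times\tilde F^n(N)$ (internal direct product). -/

import Mathlib

namespace GenFitting

/-- A minimal normal subgroup: a nontrivial normal subgroup that contains no normal subgroup of the
whole group other than the trivial one and itself. -/
def IsMinimalNormal {G : Type*} [Group G] (M : Subgroup G) : Prop :=
  M.Normal ∧ M ≠ ⊥ ∧ ∀ K : Subgroup G, K.Normal → K ≤ M → K = ⊥ ∨ K = M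

/-- The socle `Soc(G)`: the subgroup generated by all minimal normal subgroups of `G`. -/
def socle (G : Type*) [Group G] : Subgroup G :=
  sSup {M : Subgroup G | IsMinimalNormal M}

/-- The Fitting subgroup `F(G)`: the subgroup generated by all normal nilpotent subgroups of `G`
(for finite `G` it is the largest normal nilpotent subgroup). -/
def fitting (G : Type*) [Group G] : Subgroup G :=
  sSup {N : Subgroup G | N.Normal ∧ Group.IsNilpotent N}

instance fitting_normal (G : Type*) [Group G] : (fitting G).Normal :=
  Subgroup.sSup_normal _ fun _ h => h.1

/-- The product `C_G(F(G)) F(G)`. -/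
def centFitting (G : Type*) [Group G] : Subgroup G :=
  Subgroup.centralizer (fitting G : Set G) ⊔ fitting G

/-- The quasinilpotent radical `F*(G)`, i.e. the subgroup with
`F(G) ≤ F*(G) ≤ C_G(F(G)) F(G)` and `F*(G) / F(G) = Soc(C_G(F(G)) F(G) / F(G))`. -/
def fittingStar (G : Type*) [Group G] : Subgroup G :=
  ((socle (centFitting G ⧸ (fitting G).subgroupOf (centFitting G))).comap
    (QuotientGroup.mk' ((fitting G).subgroupOf (centFitting G)))).map (centFitting G).subtype

/-- The generalized Fitting subgroup: the subgroup `F̃(G)` containing the Frattini subgroup `Φ(G)`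
with `F̃(G) / Φ(G) = Soc(G / Φ(G))`. -/
def fittingTilde (G : Type*) [Group G] : Subgroup G :=
  (socle (G ⧸ frattini G)).comap (QuotientGroup.mk' (frattini G))

/-- The iterated subgroups, as subgroups of `G`: `F̃⁰(G) = G` and `F̃ⁿ⁺¹(G) = F̃(F̃ⁿ(G))`. -/
def fittingTildeIter (G : Type*) [Group G] : ℕ → Subgroup G
  | 0 => ⊤
  | n + 1 => (fittingTilde (fittingTildeIter G n)).map (fittingTildeIter G n).subtype

/-- The Frattini subgroup `Φ(K)` of a subgroup `K` of `G`, as a subgroup of `G`. -/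
def frattiniOf {G : Type*} [Group G] (K : Subgroup G) : Subgroup G :=
  (frattini K).map K.subtype

/-- `K = A × B` is the internal direct product of its subgroups `A` and `B`. -/
def IsInternalProduct {G : Type*} [Group G] (K A B : Subgroup G) : Prop :=
  A ⊔ B = K ∧ A ⊓ B = ⊥ ∧ ∀ a ∈ A, ∀ b ∈ B, Commute a b

end GenFitting

namespace GenFitting

open Subgroup
open scoped commutatorElement

universe u

/-! Everything rests on how F̃ behaves under homomorphisms. A surjection `A →* G` carries F̃(A) into
F̃(G), and F̃(A) is the full preimage when the kernel lies in Φ(A). This gives the quotient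
statements by induction on n.

For N normal in G, F̃(N) ≤ F̃(G). Since Φ(N) ≤ Φ(G), one may divide by Φ(N) and assume Φ(N) = 1, so
that F̃(N) = Soc(N). The abelian minimal normal subgroups of N generate an abelian normal subgroup
of G, which lies in F̃(G) by Gaschütz. The nonabelian ones lie in Soc(G): otherwise the offending
ones generate a perfect normal subgroup T of G, and a minimal normal subgroup of G inside T would be
central in T, hence in Z(T) ∩ T' ≤ Φ(T) ≤ Φ(N) = 1.

Consequently a normal subgroup E with F̃(E) = E lies in every iterate. F*(G) is generated by F(G)
and by subgroups of this kind, normal in C_G(F(G))F(G), which gives F*(G) ≤ F̃ⁿ(G). The same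
abelian/nonabelian dichotomy puts Soc(N) inside F*(G) when Φ(N) = 1, giving equality in the
Frattini-free case. The centralizer bound follows from C_G(F*(G)) ≤ F(G), and direct products are
handled by the two projections. -/

/-! ### Frattini subgroups of normal subgroups and quotients -/

theorem sup_inf_of_normal_le {G : Type*} [Group G] {A B M : Subgroup G} [A.Normal] (hAB : A ≤ B)
    (hB : B ≤ A ⊔ M) : A ⊔ (B ⊓ M) = B := by
  refine le_antisymm (sup_le hAB inf_le_left) fun x hx => ?_
  obtain ⟨a, ha, m, hm, rfl⟩ := mem_sup_of_normal_left.1 (hB hx)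
  exact mul_mem_sup ha ⟨(B.mul_mem_cancel_left (hAB ha)).1 hx, hm⟩

theorem frattiniOf_le {G : Type*} [Group G] (M : Subgroup G) : frattiniOf M ≤ M :=
  map_subtype_le _

theorem le_frattini_iff {G : Type*} [Group G] {K : Subgroup G} :
    K ≤ frattini G ↔ ∀ M, IsCoatom M → K ≤ M := by
  simp [frattini, Order.radical]

/-- If a maximal subgroup X misses K, Dedekind's law gives M = K(M ∩ X). As K ≤ Φ(M) is superfluous
in M, this forces K ≤ M ≤ X. Only K has to be normal: Gaschütz's argument uses a non-normal M. -/
theorem le_frattini_of_le_frattiniOf {G : Type*} [Group G] [Finite G] {K M : Subgroup G}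
    [K.Normal] (h : K ≤ frattiniOf M) : K ≤ frattini G := by
  refine le_frattini_iff.2 fun X hX => by_contra fun hK => ?_
  have htop : K ⊔ X = ⊤ := by
    rw [sup_comm]
    exact hX.2 _ (left_lt_sup.2 hK)
  have hM : K ⊔ (M ⊓ X) = M :=
    sup_inf_of_normal_le (h.trans (frattiniOf_le M)) (htop ▸ le_top)
  have h1 : X.subgroupOf M ⊔ frattini M = ⊤ := by
    rw [← (map_injective M.subtype_injective).eq_iff, Subgroup.map_sup, subgroupOf_map_subtype,
      ← MonoidHom.range_eq_map, range_subtype]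
    refine le_antisymm (sup_le inf_le_right (frattiniOf_le M)) ?_
    conv_lhs => rw [← hM]
    exact sup_le (h.trans le_sup_right) ((inf_comm M X).le.trans le_sup_left)
  have h2 := frattini_nongenerating h1
  rw [subgroupOf_eq_top] at h2
  exact hK ((h.trans (frattiniOf_le M)).trans h2)

instance frattiniOf_normal {G : Type*} [Group G] (N : Subgroup G) [N.Normal] :
    (frattiniOf N).Normal := by
  unfold frattiniOf; infer_instance

theorem frattiniOf_le_frattini {G : Type*} [Group G] [Finite G] (N : Subgroup G) [N.Normal] :
    frattiniOf N ≤ frattini G :=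
  le_frattini_of_le_frattiniOf le_rfl

theorem frattini_eq_comap {A G : Type*} [Group A] [Group G] {f : A →* G}
    (hf : Function.Surjective f) (hk : f.ker ≤ frattini A) :
    frattini A = (frattini G).comap f := by
  refine le_antisymm (frattini_le_comap_frattini_of_surjective hf) (le_frattini_iff.2 fun M hM => ?_)
  have hkM : f.ker ≤ M := hk.trans (frattini_le_coatom hM)
  have hcm : (M.map f).comap f = M := by rw [comap_map_eq, sup_eq_left.2 hkM]
  have : IsCoatom (M.map f) := by
    refine ⟨fun h => hM.1 ?_, fun L hL => ?_⟩
    · rw [← hcm, h, comap_top]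
    · have h1 : M < L.comap f := by
        rw [← hcm]
        exact (comap_lt_comap_of_surjective hf).2 hL
      have h2 := hM.2 _ h1
      rw [← map_comap_eq_self_of_surjective hf L, h2, map_top_of_surjective f hf]
  rw [← hcm]
  exact comap_mono (frattini_le_coatom this)

theorem frattini_quotient_frattini (A : Type*) [Group A] : frattini (A ⧸ frattini A) = ⊥ := by
  have h := frattini_eq_comap (QuotientGroup.mk'_surjective (frattini A))
    (by rw [QuotientGroup.ker_mk'])
  rw [← map_comap_eq_self_of_surjective (QuotientGroup.mk'_surjective (frattini A))
    (frattini (A ⧸ frattini A)), ← h, QuotientGroup.map_mk'_self]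

/-! ### Socle and F̃ under surjections -/

theorem exists_isMinimalNormal_le {G : Type*} [Group G] [Finite G] {N : Subgroup G} (hN : N.Normal)
    (h : N ≠ ⊥) : ∃ M, IsMinimalNormal M ∧ M ≤ N := by
  obtain ⟨M, hMN, hM⟩ := (Set.toFinite {K : Subgroup G | K.Normal ∧ K ≠ ⊥}).exists_le_minimal
    (show N ∈ {K : Subgroup G | K.Normal ∧ K ≠ ⊥} from ⟨hN, h⟩)
  refine ⟨M, ⟨hM.prop.1, hM.prop.2, fun K hK hKM => ?_⟩, hMN⟩
  by_cases hb : K = ⊥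
  · exact Or.inl hb
  · exact Or.inr (le_antisymm hKM (hM.le_of_le ⟨hK, hb⟩ hKM))

theorem IsMinimalNormal.le_socle {G : Type*} [Group G] {M : Subgroup G} (hM : IsMinimalNormal M) :
    M ≤ socle G :=
  le_sSup hM

theorem IsMinimalNormal.map {A G : Type*} [Group A] [Group G] {f : A →* G}
    (hf : Function.Surjective f) {M : Subgroup A} (hM : IsMinimalNormal M) (h : M.map f ≠ ⊥) :
    IsMinimalNormal (M.map f) := by
  refine ⟨hM.1.map f hf, h, fun K hK hKM => ?_⟩
  have := hM.1
  have hK' : K = (K.comap f ⊓ M).map f := by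
    refine le_antisymm (fun x hx => ?_) (by rw [map_le_iff_le_comap]; exact inf_le_left)
    obtain ⟨m, hm, rfl⟩ := hKM hx
    exact ⟨m, ⟨hx, hm⟩, rfl⟩
  rcases hM.2.2 (K.comap f ⊓ M) inferInstance inf_le_right with h0 | h0
  · left; rw [hK', h0, Subgroup.map_bot]
  · right; rw [hK', h0]

theorem map_socle_le {A G : Type*} [Group A] [Group G] {f : A →* G}
    (hf : Function.Surjective f) : (socle A).map f ≤ socle G := by
  rw [map_le_iff_le_comap]
  refine sSup_le fun M hM => ?_
  rw [← map_le_iff_le_comap]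
  by_cases h : M.map f = ⊥
  · simp [h]
  · exact (hM.map hf h).le_socle

instance socle_characteristic (G : Type*) [Group G] : (socle G).Characteristic :=
  characteristic_iff_map_le.2 fun φ => map_socle_le φ.surjective

theorem map_fittingTilde_le_of_surjective {A G : Type*} [Group A] [Group G] {f : A →* G}
    (hf : Function.Surjective f) : (fittingTilde A).map f ≤ fittingTilde G := by
  rintro _ ⟨a, ha, rfl⟩
  let g : A ⧸ frattini A →* G ⧸ frattini G :=
    QuotientGroup.map _ _ f (frattini_le_comap_frattini_of_surjective hf)
  have hg : Function.Surjective g := QuotientGroup.map_surjective_of_surjective _ _ _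
    ((QuotientGroup.mk'_surjective _).comp hf) _
  exact map_socle_le hg ⟨_, ha, rfl⟩

instance fittingTilde_characteristic (G : Type*) [Group G] : (fittingTilde G).Characteristic :=
  characteristic_iff_map_le.2 fun φ => map_fittingTilde_le_of_surjective φ.surjective

theorem socle_le_fittingTilde (G : Type*) [Group G] : socle G ≤ fittingTilde G :=
  map_le_iff_le_comap.1 (map_socle_le (QuotientGroup.mk'_surjective (frattini G)))

theorem frattini_le_fittingTilde (G : Type*) [Group G] : frattini G ≤ fittingTilde G := by
  conv_lhs => rw [← QuotientGroup.ker_mk' (frattini G)]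
  exact ker_le_comap _ _

theorem fittingTilde_eq_socle {G : Type*} [Group G] (h : frattini G = ⊥) :
    fittingTilde G = socle G := by
  refine le_antisymm (fun x hx => ?_) (socle_le_fittingTilde G)
  let g : G ⧸ frattini G →* G := QuotientGroup.lift _ (MonoidHom.id G) (by simp [h])
  have hg : Function.Surjective g := fun x => ⟨(x : G ⧸ frattini G), rfl⟩
  exact map_socle_le hg ⟨_, hx, rfl⟩

/-- The quotient map A → A/Φ(A) factors through f. Pushing F̃(G) along the induced map lands in
F̃(A/Φ(A)), which is the socle because A/Φ(A) is Frattini-free. -/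
theorem fittingTilde_eq_comap {A G : Type*} [Group A] [Group G] {f : A →* G}
    (hf : Function.Surjective f) (hk : f.ker ≤ frattini A) :
    fittingTilde A = (fittingTilde G).comap f := by
  refine le_antisymm (map_le_iff_le_comap.1 (map_fittingTilde_le_of_surjective hf)) fun a ha => ?_
  let g : G →* A ⧸ frattini A := MonoidHom.liftOfSurjective f hf
    ⟨QuotientGroup.mk' (frattini A), by rwa [QuotientGroup.ker_mk']⟩
  have hgf : ∀ a, g (f a) = QuotientGroup.mk' (frattini A) a := fun a =>
    MonoidHom.liftOfRightInverse_comp_apply _ _ _ _ _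
  have hg : Function.Surjective g := fun x => by
    obtain ⟨a, rfl⟩ := QuotientGroup.mk'_surjective _ x
    exact ⟨f a, hgf a⟩
  have h := map_fittingTilde_le_of_surjective hg ⟨f a, ha, rfl⟩
  rw [fittingTilde_eq_socle (frattini_quotient_frattini A), hgf] at h
  exact h

/-! ### Abelian and nilpotent normal subgroups -/

/-- A centralizes A ∩ M because it is abelian, M normalizes it because A is normal, and together
they generate G. -/
theorem normal_inf_of_sup_eq_top {G : Type*} [Group G] {A M : Subgroup G} [A.Normal]
    (hA : A ≤ centralizer A) (h : A ⊔ M = ⊤) : (A ⊓ M).Normal := by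
  refine ⟨fun x hx g => ?_⟩
  obtain ⟨m, hm, a, ha, rfl⟩ := mem_sup_of_normal_right.1 (show g ∈ M ⊔ A by rw [sup_comm, h]; trivial)
  have hax : a * x * a⁻¹ = x := by
    rw [mul_inv_eq_iff_eq_mul]
    exact (mem_centralizer_iff.1 (hA ha) x hx.1).symm
  have : m * a * x * (m * a)⁻¹ = m * x * m⁻¹ := by
    conv_rhs => rw [← hax]
    group
  rw [this]
  exact ⟨Normal.conj_mem inferInstance x hx.1 m, M.mul_mem (M.mul_mem hm hx.2) (M.inv_mem hm)⟩

/-- Gaschütz: abelian normal subgroups of Frattini-free groups lie in the socle. -/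
theorem le_socle_of_le_centralizer {G : Type*} [Group G] [Finite G] (hΦ : frattini G = ⊥)
    {A : Subgroup G} [A.Normal] (hA : A ≤ centralizer A) : A ≤ socle G := by
  set S := A ⊓ socle G with hS
  have hSS : S ≤ centralizer S := (inf_le_left.trans hA).trans (centralizer_le inf_le_left)
  -- M is a minimal supplement of S = A ∩ Soc(G). It turns out to complement both S and A, which
  -- forces S = A.
  obtain ⟨M, -, hM⟩ := (Set.toFinite {M : Subgroup G | S ⊔ M = ⊤}).exists_le_minimal
    (show ⊤ ∈ {M : Subgroup G | S ⊔ M = ⊤} from sup_top_eq S)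
  have hSM : S ⊔ M = ⊤ := hM.prop
  have hAM : A ⊔ M = ⊤ := top_le_iff.1 (hSM.symm.le.trans (sup_le_sup_right inf_le_left M))
  have hKn := normal_inf_of_sup_eq_top hSS hSM
  have hBn := normal_inf_of_sup_eq_top hA hAM
  have hK : S ⊓ M = ⊥ := by
    have h1 : S ⊓ M ≤ frattiniOf M := by
      have : (S ⊓ M).subgroupOf M ≤ frattini M := by
        -- A maximal subgroup of M not containing S ∩ M would be a smaller supplement of S.
        refine le_frattini_iff.2 fun X hX => by_contra fun hKX => ?_
        have h2 : X ⊔ (S ⊓ M).subgroupOf M = ⊤ := hX.2 _ (left_lt_sup.2 hKX)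
        have h3 : X.map M.subtype ⊔ (S ⊓ M) = M := by
          have := congrArg (Subgroup.map M.subtype) h2
          rwa [Subgroup.map_sup, subgroupOf_map_subtype, ← MonoidHom.range_eq_map, range_subtype,
            inf_assoc, inf_idem] at this
        have h4 : S ⊔ X.map M.subtype = ⊤ := by
          refine top_le_iff.1 (hSM.symm.le.trans (sup_le le_sup_left ?_))
          conv_lhs => rw [← h3]
          exact sup_le le_sup_right (inf_le_left.trans le_sup_left)
        have h5 : M ≤ X.map M.subtype := hM.le_of_le h4 (map_subtype_le _)
        refine hX.1 (top_le_iff.1 fun x _ => ?_)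
        obtain ⟨y, hy, hxy⟩ := h5 x.2
        rwa [← Subtype.ext hxy]
      have := Subgroup.map_mono (f := M.subtype) this
      rwa [subgroupOf_map_subtype, inf_assoc, inf_idem] at this
    exact le_bot_iff.1 (hΦ ▸ le_frattini_of_le_frattiniOf h1)
  have hB : A ⊓ M = ⊥ := by
    by_contra hne
    obtain ⟨L, hL, hLB⟩ := exists_isMinimalNormal_le hBn hne
    exact hL.2.1 (le_bot_iff.1 (hK ▸ le_inf (le_inf (hLB.trans inf_le_left) hL.le_socle)
      (hLB.trans inf_le_right)))
  have h6 : S ⊔ (A ⊓ M) = A := sup_inf_of_normal_le inf_le_left (hSM ▸ le_top)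
  rw [hB, sup_bot_eq] at h6
  exact inf_eq_left.1 h6

/-- Maximal subgroups M of a nilpotent group are normal. The preimage of the nontrivial centre of
N/M properly contains M, so it is everything and N/M is abelian. -/
theorem commutator_le_frattini (N : Type*) [Group N] [Finite N] [Group.IsNilpotent N] :
    commutator N ≤ frattini N := by
  refine le_frattini_iff.2 fun M hM => ?_
  have hMn : M.Normal := NormalizerCondition.normal_of_coatom M Group.normalizerCondition_of_isNilpotent hM
  have : Nontrivial (N ⧸ M) := QuotientGroup.nontrivial_iff.2 hM.1
  have hc := Group.IsNilpotent.center_ne_bot (G := N ⧸ M)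
  have h1 : (center (N ⧸ M)).comap (QuotientGroup.mk' M) = ⊤ := by
    refine hM.2 _ (lt_of_le_of_ne ?_ fun h => hc ?_)
    · conv_lhs => rw [← QuotientGroup.ker_mk' M]
      exact ker_le_comap _ _
    · rw [← map_comap_eq_self_of_surjective (QuotientGroup.mk'_surjective M) (center (N ⧸ M)), ← h,
        QuotientGroup.map_mk'_self]
  rw [commutator_def, commutator_le]
  intro a _ b _
  rw [← QuotientGroup.eq_one_iff]
  have ha : (a : N ⧸ M) ∈ center (N ⧸ M) := by
    have : a ∈ (center (N ⧸ M)).comap (QuotientGroup.mk' M) := h1 ▸ mem_top a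
    exact this
  exact commutatorElement_eq_one_iff_mul_comm.2 ((mem_center_iff.1 ha b).symm)

theorem isNilpotent_of_commutator_le_center {D : Type*} [Group D] (h : commutator D ≤ center D) :
    Group.IsNilpotent D :=
  Subgroup.isNilpotent_of_ker_le_center (Abelianization.of (G := D))
    (by rwa [Abelianization.ker_of])

theorem isNilpotent_of_commutator_le_centralizer {G : Type*} [Group G] {D : Subgroup G}
    (h : ⁅D, D⁆ ≤ centralizer D) : Group.IsNilpotent D := by
  refine isNilpotent_of_commutator_le_center fun x hx => mem_center_iff.2 fun y => Subtype.ext ?_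
  have : (x : G) ∈ ⁅D, D⁆ := by
    rw [← map_subtype_commutator]
    exact ⟨x, hx, rfl⟩
  exact mem_centralizer_iff.1 (h this) y y.2

theorem isNilpotent_of_le_centralizer {G : Type*} [Group G] {D : Subgroup G}
    (h : D ≤ centralizer D) : Group.IsNilpotent D :=
  isNilpotent_of_commutator_le_centralizer <|
    (commutator_eq_bot_iff_le_centralizer.2 h).le.trans bot_le

theorem le_socle_of_isNilpotent {G : Type*} [Group G] [Finite G] (hΦ : frattini G = ⊥)
    {N : Subgroup G} [N.Normal] [Group.IsNilpotent N] : N ≤ socle G := by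
  refine le_socle_of_le_centralizer hΦ (commutator_eq_bot_iff_le_centralizer.1 (le_bot_iff.1 ?_))
  rw [← hΦ, ← map_subtype_commutator]
  exact (Subgroup.map_mono (commutator_le_frattini N)).trans (frattiniOf_le_frattini N)

theorem le_fittingTilde_of_isNilpotent {G : Type*} [Group G] [Finite G]
    {N : Subgroup G} [hN : N.Normal] [Group.IsNilpotent N] : N ≤ fittingTilde G := by
  have : (N.map (QuotientGroup.mk' (frattini G))).Normal :=
    hN.map _ (QuotientGroup.mk'_surjective _)
  have : Group.IsNilpotent (N.map (QuotientGroup.mk' (frattini G))) :=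
    Group.nilpotent_of_surjective _ (MonoidHom.subgroupMap_surjective _ N)
  exact map_le_iff_le_comap.1 (le_socle_of_isNilpotent (frattini_quotient_frattini G))

/-! ### Minimal normal subgroups of G and of its normal subgroups -/

/-- Soc(X) is characteristic in X, so L ∩ Soc(X) is normal in G. It is nontrivial because L contains
a minimal normal subgroup of X. -/
theorem IsMinimalNormal.le_map_socle {G : Type*} [Group G] [Finite G] {L X : Subgroup G}
    [X.Normal] (hL : IsMinimalNormal L) (hLX : L ≤ X) : L ≤ (socle X).map X.subtype := by
  have := hL.1
  have hne : L.subgroupOf X ≠ ⊥ := fun h => hL.2.1 <| by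
    rw [← map_subgroupOf_eq_of_le hLX, h, Subgroup.map_bot]
  obtain ⟨A, hA, hAL⟩ := exists_isMinimalNormal_le (N := L.subgroupOf X) inferInstance hne
  have hA1 : A.map X.subtype ≤ L := by
    rw [← map_subgroupOf_eq_of_le hLX]
    exact Subgroup.map_mono hAL
  have hA2 : A.map X.subtype ≤ (socle X).map X.subtype := Subgroup.map_mono hA.le_socle
  rcases hL.2.2 (L ⊓ (socle X).map X.subtype) inferInstance inf_le_left with h | h
  · refine absurd ?_ hA.2.1
    rw [← (map_injective X.subtype_injective).eq_iff, Subgroup.map_bot]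
    exact le_bot_iff.1 (h ▸ le_inf hA1 hA2)
  · exact inf_eq_left.1 h

/-- If a maximal subgroup M does not contain Z(E), then E = M Z(E), and central factors drop out of
commutators, so E' ≤ M. -/
theorem center_inf_commutator_le_frattini (E : Type*) [Group E] :
    center E ⊓ commutator E ≤ frattini E := by
  refine le_frattini_iff.2 fun M hM => by_contra fun h => h (inf_le_right.trans ?_)
  have htop : M ⊔ center E = ⊤ := hM.2 _ (left_lt_sup.2 fun h' => h (inf_le_left.trans h'))
  rw [commutator_def, commutator_le]
  intro x _ y _
  obtain ⟨m, hm, z, hz, rfl⟩ := mem_sup_of_normal_right.1 (htop ▸ mem_top x)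
  obtain ⟨m', hm', z', hz', rfl⟩ := mem_sup_of_normal_right.1 (htop ▸ mem_top y)
  have h1 : ⁅m * z, m' * z'⁆ = ⁅m, m'⁆ := by
    have a1 := mem_center_iff.1 hz
    have a2 := mem_center_iff.1 hz'
    simp only [commutatorElement_def]
    have : m * z * (m' * z') = m * m' * (z * z') := by
      rw [mul_assoc, ← mul_assoc z, ← a1 m', mul_assoc m', ← mul_assoc m]
    rw [this]
    have : m' * z' * (m * z) = m' * m * (z * z') := by
      rw [mul_assoc, ← mul_assoc z', ← a2 m, mul_assoc m, ← mul_assoc m', a1 z']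
    have h2 : (m * z)⁻¹ * (m' * z')⁻¹ = (m' * m * (z * z'))⁻¹ := by rw [← this, mul_inv_rev (m' * z')]
    rw [mul_assoc _ (m * z)⁻¹, h2]
    group
  rw [h1]
  exact M.mul_mem (M.mul_mem (M.mul_mem hm hm') (M.inv_mem hm)) (M.inv_mem hm')

theorem le_frattiniOf_of_le_commutator {G : Type*} [Group G] {Z E : Subgroup G}
    (hZ : Z ≤ centralizer E) (h : Z ≤ ⁅E, E⁆) : Z ≤ frattiniOf E := by
  intro x hx
  have hx1 := h hx
  rw [← map_subtype_commutator] at hx1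
  obtain ⟨y, hy, rfl⟩ := hx1
  exact ⟨y, center_inf_commutator_le_frattini E
    ⟨mem_center_iff.2 fun z => Subtype.ext (mem_centralizer_iff.1 (hZ hx) z z.2), hy⟩, rfl⟩

theorem IsMinimalNormal.commutator_eq {G : Type*} [Group G] {M : Subgroup G}
    (hM : IsMinimalNormal M) (h : ¬ M ≤ centralizer M) : ⁅M, M⁆ = M := by
  have := hM.1
  exact (hM.2.2 _ inferInstance (commutator_le_left M M)).resolve_left fun h' =>
    h (commutator_eq_bot_iff_le_centralizer.1 h')

theorem IsMinimalNormal.le_centralizer {G : Type*} [Group G] {M L : Subgroup G}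
    (hM : IsMinimalNormal M) (hL : L.Normal) (h : ¬ M ≤ L) : L ≤ centralizer M := by
  have := hM.1
  have hd : Disjoint L M := by
    rw [disjoint_iff]
    exact (hM.2.2 _ inferInstance inf_le_right).resolve_right fun h' => h (inf_eq_right.1 h')
  exact fun x hx => mem_centralizer_iff.2 fun m hm =>
    ((commute_of_normal_of_disjoint L M hL hM.1 hd x m hx hm).eq).symm

theorem IsMinimalNormal.map_equiv {A G : Type*} [Group A] [Group G] (e : A ≃* G)
    {M : Subgroup A} (hM : IsMinimalNormal M) : IsMinimalNormal (M.map (e : A →* G)) :=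
  IsMinimalNormal.map (f := (e : A →* G)) e.surjective hM
    fun h => hM.2.1 ((map_eq_bot_iff_of_injective _ e.injective).1 h)

theorem map_sSup_normal {G : Type*} [Group G] {N : Subgroup G} [N.Normal] {S : Set (Subgroup N)}
    (hS : ∀ g : G, ∀ M ∈ S, M.map (MulAut.conjNormal g : N ≃* N).toMonoidHom ∈ S) :
    ((sSup S).map N.subtype).Normal := by
  refine ⟨?_⟩
  rintro _ ⟨x, hx, rfl⟩ g
  have h : sSup S ≤ (sSup S).comap (MulAut.conjNormal g : N ≃* N).toMonoidHom :=
    sSup_le fun M hM => map_le_iff_le_comap.1 (le_sSup (hS g M hM))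
  exact ⟨_, h hx, MulAut.conjNormal_apply g x⟩

theorem map_le_centralizer_map_iff {A G : Type*} [Group A] [Group G] {f : A →* G}
    (hf : Function.Injective f) {M : Subgroup A} :
    M.map f ≤ centralizer (M.map f) ↔ M ≤ centralizer M := by
  rw [← commutator_eq_bot_iff_le_centralizer, ← commutator_eq_bot_iff_le_centralizer,
    ← map_commutator, map_eq_bot_iff_of_injective _ hf]

theorem sSup_le_centralizer_sSup {G : Type*} [Group G] {S T : Set (Subgroup G)}
    (h : ∀ M ∈ S, ∀ L ∈ T, M ≤ centralizer L) : sSup S ≤ centralizer (sSup T : Subgroup G) := by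
  refine sSup_le fun M hM => le_centralizer_iff.1 (sSup_le fun L hL => ?_)
  exact le_centralizer_iff.1 (h M hM L hL)

/-- An abelian minimal normal subgroup of a normal subgroup `N` of `G` lies in an abelian normal
subgroup of `G`. -/
theorem IsMinimalNormal.exists_normal_le_centralizer {G : Type*} [Group G] {N : Subgroup G}
    [N.Normal] {M : Subgroup N} (hM : IsMinimalNormal M) (hMc : M ≤ centralizer M) :
    ∃ B : Subgroup G, B.Normal ∧ B ≤ centralizer B ∧ B ≤ N ∧ M.map N.subtype ≤ B := by
  -- The witness is the join of all abelian minimal normal subgroups of N: conjugation by G permutes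
  -- them, and distinct ones commute.
  let S : Set (Subgroup N) := {M | IsMinimalNormal M ∧ M ≤ centralizer M}
  refine ⟨(sSup S).map N.subtype, map_sSup_normal ?_, ?_, map_subtype_le _,
    Subgroup.map_mono (le_sSup ⟨hM, hMc⟩)⟩
  · exact fun g L hL => ⟨hL.1.map_equiv (MulAut.conjNormal g : N ≃* N),
      (map_le_centralizer_map_iff (MulAut.conjNormal g : N ≃* N).injective).2 hL.2⟩
  · rw [map_le_centralizer_map_iff N.subtype_injective]
    refine sSup_le_centralizer_sSup fun L hL K hK => ?_
    by_cases h : K ≤ L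
    · rcases hL.1.2.2 K hK.1.1 h with h' | h'
      · exact absurd h' hK.1.2.1
      · exact h' ▸ hL.2
    · exact hK.1.le_centralizer hL.1.1 h

/-- A nonabelian minimal normal subgroup of a Frattini-free normal subgroup of `G` lies in the
socle of `G`. -/
theorem IsMinimalNormal.map_le_socle {G : Type*} [Group G] [Finite G] {N : Subgroup G} [N.Normal]
    (hΦ : frattini N = ⊥) {M : Subgroup N} (hM : IsMinimalNormal M) (hMc : ¬ M ≤ centralizer M) :
    M.map N.subtype ≤ socle G := by
  by_contra hMS
  let S : Set (Subgroup N) :=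
    {M | IsMinimalNormal M ∧ ¬ M ≤ centralizer M ∧ ¬ M.map N.subtype ≤ socle G}
  have hTN : (sSup S).Normal := Subgroup.sSup_normal _ fun _ h => h.1.1
  have hT : ((sSup S).map N.subtype).Normal := by
    refine map_sSup_normal fun g L hL => ⟨hL.1.map_equiv (MulAut.conjNormal g : N ≃* N),
      fun h => hL.2.1 ((map_le_centralizer_map_iff (MulAut.conjNormal g : N ≃* N).injective).1 h),
      fun h => hL.2.2 ?_⟩
    rintro _ ⟨x, hx, rfl⟩
    have := Normal.conj_mem (H := socle G) inferInstance _ (h ⟨_, ⟨x, hx, rfl⟩, rfl⟩) g⁻¹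
    simpa [MulAut.conjNormal_apply, mul_assoc] using this
  have hne : (sSup S).map N.subtype ≠ ⊥ := fun h => hM.2.1 <| le_bot_iff.1 <| by
    rw [map_eq_bot_iff_of_injective _ N.subtype_injective] at h
    exact h ▸ le_sSup ⟨hM, hMc, hMS⟩
  obtain ⟨L, hL, hLT⟩ := exists_isMinimalNormal_le hT hne
  have := hL.1
  have hLN : L ≤ N := hLT.trans (map_subtype_le _)
  have hL' : (L.subgroupOf N).map N.subtype = L := map_subgroupOf_eq_of_le hLN
  -- No member K of S lies in L, since L ≤ Soc(G); hence L commutes with each K.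
  have h1 : L.subgroupOf N ≤ centralizer (sSup S : Subgroup N) := by
    refine le_centralizer_iff.1 (sSup_le fun K hK => le_centralizer_iff.1 ?_)
    refine hK.1.le_centralizer inferInstance fun h => hK.2.2 ?_
    exact (Subgroup.map_mono h).trans (hL'.le.trans hL.le_socle)
  have h2 : sSup S ≤ ⁅sSup S, sSup S⁆ := sSup_le fun K hK => by
    conv_lhs => rw [← hK.1.commutator_eq hK.2.1]
    exact commutator_mono (le_sSup hK) (le_sSup hK)
  have h3 : L.subgroupOf N ≤ sSup S := by
    rwa [← map_subtype_le_map_subtype, hL']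
  -- L is central in the perfect group `sSup S`, so it lies in the Frattini subgroup of that group.
  have h4 : L.subgroupOf N ≤ frattini N :=
    (le_frattiniOf_of_le_commutator h1 (h3.trans h2)).trans (frattiniOf_le_frattini _)
  rw [hΦ, le_bot_iff] at h4
  exact hL.2.1 (by rw [← hL', h4, Subgroup.map_bot])

/-! ### Monotonicity of F̃ on normal subgroups -/

theorem map_fittingTilde_le_of_frattini_eq_bot {G : Type*} [Group G] [Finite G] {N : Subgroup G}
    [N.Normal] (hΦ : frattini N = ⊥) : (fittingTilde N).map N.subtype ≤ fittingTilde G := by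
  rw [fittingTilde_eq_socle hΦ, map_le_iff_le_comap]
  refine sSup_le fun M hM => map_le_iff_le_comap.1 ?_
  by_cases h : M ≤ centralizer M
  · obtain ⟨B, hB, hBB, -, hMB⟩ := IsMinimalNormal.exists_normal_le_centralizer hM h
    have := isNilpotent_of_le_centralizer hBB
    exact hMB.trans le_fittingTilde_of_isNilpotent
  · exact (IsMinimalNormal.map_le_socle hΦ hM h).trans (socle_le_fittingTilde G)

theorem map_subtype_fittingTilde_le {G : Type*} [Group G] [Finite G] (N : Subgroup G)
    [hN : N.Normal] : (fittingTilde N).map N.subtype ≤ fittingTilde G := by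
  let f := QuotientGroup.mk' (frattiniOf N)
  have hf : Function.Surjective f := QuotientGroup.mk'_surjective _
  have hk : f.ker ≤ frattini G := by
    rw [QuotientGroup.ker_mk']
    exact frattiniOf_le_frattini N
  have hNf : (N.map f).Normal := hN.map f hf
  have hr : Function.Surjective (f.subgroupMap N) := f.subgroupMap_surjective N
  have hrk : (f.subgroupMap N).ker = frattini N := by
    ext x
    have : x ∈ (f.subgroupMap N).ker ↔ (x : G) ∈ f.ker := by
      simp [MonoidHom.mem_ker, Subtype.ext_iff]
    rw [this, QuotientGroup.ker_mk', frattiniOf, mem_map_iff_mem N.subtype_injective |>.symm]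
    rfl
  have hΦ : frattini (N.map f) = ⊥ := by
    rw [← map_comap_eq_self_of_surjective hr (frattini (N.map f)), ← frattini_eq_comap hr hrk.le,
      ← hrk, Subgroup.map_eq_bot_iff]
  rw [fittingTilde_eq_comap hf hk, map_le_iff_le_comap]
  intro x hx
  exact map_fittingTilde_le_of_frattini_eq_bot hΦ
    ⟨_, map_fittingTilde_le_of_surjective hr ⟨x, hx, rfl⟩, rfl⟩

/-- Combines the surjective and the normal-inclusion cases through the image of f; this is the form
that drives the inductions on n. -/
theorem map_fittingTilde_le {A G : Type*} [Group A] [Group G] [Finite G] (f : A →* G)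
    (hf : f.range.Normal) : (fittingTilde A).map f ≤ fittingTilde G := by
  rw [map_le_iff_le_comap]
  intro x hx
  exact map_subtype_fittingTilde_le f.range
    ⟨_, map_fittingTilde_le_of_surjective f.rangeRestrict_surjective ⟨x, hx, rfl⟩, rfl⟩

/-! ### The iterates F̃ⁿ -/

theorem fittingTildeIter_succ_le (G : Type*) [Group G] (n : ℕ) :
    fittingTildeIter G (n + 1) ≤ fittingTildeIter G n :=
  map_subtype_le _

theorem map_fittingTildeIter_succ_le {A G : Type*} [Group A] [Group G] [Finite G] {f : A →* G}
    {n : ℕ} (h : (fittingTildeIter A n).map f ≤ fittingTildeIter G n)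
    (hn : ((fittingTildeIter A n).map f).Normal) :
    (fittingTildeIter A (n + 1)).map f ≤ fittingTildeIter G (n + 1) := by
  let r : fittingTildeIter A n →* fittingTildeIter G n :=
    (inclusion h).comp (f.subgroupMap (fittingTildeIter A n))
  have hr : r.range = ((fittingTildeIter A n).map f).subgroupOf (fittingTildeIter G n) := by
    rw [MonoidHom.range_comp, MonoidHom.range_eq_top.2 (f.subgroupMap_surjective _),
      ← MonoidHom.range_eq_map, inclusion_range]
  rintro _ ⟨_, ⟨x, hx, rfl⟩, rfl⟩
  exact ⟨r x, map_fittingTilde_le r (hr ▸ inferInstance) ⟨x, hx, rfl⟩, rfl⟩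

/-- The groups are quantified inside the induction, in a common universe, so that the hypothesis
also applies to automorphisms of A. This makes the n-th iterate characteristic and its image normal,
as the next step requires. -/
theorem map_fittingTildeIter_le_of_surjective (n : ℕ) : ∀ {A G : Type u} [Group A] [Group G]
    [Finite A] [Finite G] {f : A →* G}, Function.Surjective f →
    (fittingTildeIter A n).map f ≤ fittingTildeIter G n := by
  induction n with
  | zero => exact fun _ => le_top
  | succ n ih =>
    intro A G _ _ _ _ f hf
    have : (fittingTildeIter A n).Characteristic :=
      characteristic_iff_map_le.2 fun φ => ih (f := φ.toMonoidHom) φ.surjective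
    exact map_fittingTildeIter_succ_le (ih hf) (Normal.map inferInstance f hf)

instance fittingTildeIter_characteristic (G : Type u) [Group G] [Finite G] (n : ℕ) :
    (fittingTildeIter G n).Characteristic :=
  characteristic_iff_map_le.2 fun φ => map_fittingTildeIter_le_of_surjective n φ.surjective

theorem map_subtype_fittingTildeIter_le {G : Type u} [Group G] [Finite G] (N : Subgroup G)
    [N.Normal] (n : ℕ) : (fittingTildeIter N n).map N.subtype ≤ fittingTildeIter G n := by
  induction n with
  | zero => exact le_top
  | succ n ih => exact map_fittingTildeIter_succ_le ih inferInstance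

theorem map_fittingTildeIter_succ_eq {A G : Type*} [Group A] [Group G] [Finite G] {f : A →* G}
    {n : ℕ} (h : (fittingTildeIter A n).map f = fittingTildeIter G n)
    (hk : f.ker ≤ frattiniOf (fittingTildeIter A n)) :
    (fittingTildeIter A (n + 1)).map f = fittingTildeIter G (n + 1) := by
  let r : fittingTildeIter A n →* fittingTildeIter G n :=
    (inclusion h.le).comp (f.subgroupMap (fittingTildeIter A n))
  have hr : Function.Surjective r := by
    rintro ⟨y, hy⟩
    obtain ⟨x, hx, rfl⟩ := h.ge hy
    exact ⟨⟨x, hx⟩, rfl⟩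
  have hrk : r.ker ≤ frattini (fittingTildeIter A n) := by
    intro x hx
    have hx' : (x : A) ∈ f.ker := congrArg Subtype.val (MonoidHom.mem_ker.1 hx)
    obtain ⟨y, hy, hyx⟩ := hk hx'
    rwa [← Subtype.ext hyx]
  have hT := fittingTilde_eq_comap hr hrk
  refine le_antisymm ?_ ?_
  · rintro _ ⟨_, ⟨x, hx, rfl⟩, rfl⟩
    exact ⟨r x, hT.le hx, rfl⟩
  · rintro _ ⟨y, hy, rfl⟩
    obtain ⟨x, rfl⟩ := hr y
    exact ⟨x, ⟨x, hT.ge hy, rfl⟩, rfl⟩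

/-- Makes Φ(F̃ⁿ) decreasing in n, so a kernel contained in one of these subgroups is contained in
all the earlier ones. -/
theorem frattiniOf_mono {G : Type*} [Group G] [Finite G] {M N : Subgroup G} [M.Normal]
    (h : M ≤ N) : frattiniOf M ≤ frattiniOf N := by
  have h1 : (frattiniOf M).subgroupOf N ≤ frattiniOf (M.subgroupOf N) := by
    rintro ⟨_, hN⟩ ⟨x, hx, rfl⟩
    exact ⟨_, frattini_le_comap_frattini_of_surjective
      (φ := (subgroupOfEquivOfLe h).symm.toMonoidHom) (subgroupOfEquivOfLe h).symm.surjective hx,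
      rfl⟩
  have h2 := le_frattini_of_le_frattiniOf h1
  rw [← map_subtype_le_map_subtype, map_subgroupOf_eq_of_le ((frattiniOf_le M).trans h)] at h2
  exact h2

theorem map_fittingTildeIter_eq {A G : Type u} [Group A] [Group G] [Finite A] [Finite G]
    {f : A →* G} (hf : Function.Surjective f) (n : ℕ)
    (hk : f.ker ≤ frattiniOf (fittingTildeIter A n)) :
    (fittingTildeIter A n).map f = fittingTildeIter G n := by
  induction n with
  | zero => exact map_top_of_surjective f hf
  | succ n ih =>
    have hk' := hk.trans (frattiniOf_mono (fittingTildeIter_succ_le A n))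
    exact map_fittingTildeIter_succ_eq (ih hk') hk'

theorem frattiniOf_fittingTildeIter_le (G : Type*) [Group G] (n : ℕ) :
    frattiniOf (fittingTildeIter G n) ≤ fittingTildeIter G (n + 1) :=
  Subgroup.map_mono (frattini_le_fittingTilde _)

theorem map_subtype_fittingTilde_eq_top {G : Type*} [Group G] (h : fittingTilde G = ⊤)
    {K : Subgroup G} (hK : K = ⊤) : (fittingTilde K).map K.subtype = ⊤ := by
  subst hK
  refine top_le_iff.1 fun x hx => ?_
  exact ⟨⟨x, hx⟩, map_fittingTilde_le_of_surjective
    (f := (topEquiv (G := G)).symm.toMonoidHom) topEquiv.symm.surjective ⟨x, h.ge hx, rfl⟩, rfl⟩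

theorem fittingTildeIter_eq_top {G : Type*} [Group G] (h : fittingTilde G = ⊤) (n : ℕ) :
    fittingTildeIter G n = ⊤ := by
  induction n with
  | zero => rfl
  | succ n ih => exact map_subtype_fittingTilde_eq_top h ih

theorem le_fittingTildeIter {G : Type*} [Group G] [Finite G] {N : Subgroup G} [N.Normal]
    (h : fittingTilde N = ⊤) (n : ℕ) : N ≤ fittingTildeIter G n := by
  have := map_subtype_fittingTildeIter_le N n
  rwa [fittingTildeIter_eq_top h, ← MonoidHom.range_eq_map, range_subtype] at this

theorem fittingTilde_eq_top_of_isNilpotent (N : Type*) [Group N] [Finite N]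
    [Group.IsNilpotent N] : fittingTilde N = ⊤ := by
  have := Group.isNilpotent_top.2 ‹Group.IsNilpotent N›
  exact top_le_iff.1 le_fittingTilde_of_isNilpotent

theorem fitting_le_fittingTildeIter (G : Type*) [Group G] [Finite G] (n : ℕ) :
    fitting G ≤ fittingTildeIter G n := by
  refine sSup_le fun N ⟨hN, hN'⟩ => ?_
  exact le_fittingTildeIter (fittingTilde_eq_top_of_isNilpotent N) n

/-! ### The quasinilpotent radical F* -/

theorem le_fitting {G : Type*} [Group G] {N : Subgroup G} (hN : N.Normal)
    (h : Group.IsNilpotent N) : N ≤ fitting G :=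
  le_sSup ⟨hN, h⟩

/-- The image of `C_G(F(G)) F(G)` in `G / F(G)`. -/
def centFittingQuot (G : Type*) [Group G] : Subgroup (G ⧸ fitting G) :=
  (centFitting G).map (QuotientGroup.mk' (fitting G))

instance centFitting_normal (G : Type*) [Group G] : (centFitting G).Normal := by
  unfold centFitting; infer_instance

instance centFittingQuot_normal (G : Type*) [Group G] : (centFittingQuot G).Normal :=
  Normal.map inferInstance _ (QuotientGroup.mk'_surjective _)

theorem fitting_le_centFitting (G : Type*) [Group G] : fitting G ≤ centFitting G :=
  le_sup_right

theorem centralizer_le_centFitting (G : Type*) [Group G] :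
    centralizer (fitting G : Set G) ≤ centFitting G :=
  le_sup_left

theorem centFittingQuot_eq (G : Type*) [Group G] :
    centFittingQuot G = (centralizer (fitting G : Set G)).map (QuotientGroup.mk' (fitting G)) := by
  rw [centFittingQuot, centFitting, Subgroup.map_sup, QuotientGroup.map_mk'_self, sup_bot_eq]

theorem socle_eq_comap {A G : Type*} [Group A] [Group G] (e : A ≃* G) :
    socle A = (socle G).comap e.toMonoidHom := by
  refine le_antisymm (map_le_iff_le_comap.1 (map_socle_le e.surjective)) fun x hx => ?_
  have := map_socle_le (f := e.symm.toMonoidHom) e.symm.surjective ⟨_, hx, rfl⟩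
  simpa using this

/-- Moves the socle into a normal subgroup of G/F(G), where the results on minimal normal subgroups
of normal subgroups apply. -/
theorem fittingStar_eq (G : Type*) [Group G] :
    fittingStar G = ((socle (centFittingQuot G)).map (centFittingQuot G).subtype).comap
      (QuotientGroup.mk' (fitting G)) := by
  let g := (QuotientGroup.mk' (fitting G)).subgroupMap (centFitting G)
  have hg : Function.Surjective g := MonoidHom.subgroupMap_surjective _ _
  have hk : g.ker = (fitting G).subgroupOf (centFitting G) := by
    ext x
    have : g x = 1 ↔ QuotientGroup.mk' (fitting G) x = 1 := by rw [Subtype.ext_iff]; rfl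
    rw [MonoidHom.mem_ker, this, ← MonoidHom.mem_ker, QuotientGroup.ker_mk', mem_subgroupOf]
  let e : centFitting G ⧸ (fitting G).subgroupOf (centFitting G) ≃* centFittingQuot G :=
    (QuotientGroup.quotientMulEquivOfEq hk.symm).trans
      (QuotientGroup.quotientKerEquivOfSurjective g hg)
  have he : ∀ x, e (QuotientGroup.mk' _ x) = g x := fun x => rfl
  rw [fittingStar, socle_eq_comap e]
  ext x
  constructor
  · rintro ⟨y, hy, rfl⟩
    exact ⟨_, hy, rfl⟩
  · rintro ⟨y, hy, hyx⟩
    obtain ⟨z, rfl⟩ := hg y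
    have hx : x ∈ centFitting G := by
      have h1 : (z : G)⁻¹ * x ∈ fitting G := QuotientGroup.eq.1 hyx
      exact ((centFitting G).mul_mem_cancel_left ((centFitting G).inv_mem z.2)).1
        (fitting_le_centFitting G h1)
    refine ⟨⟨x, hx⟩, ?_, rfl⟩
    have : g ⟨x, hx⟩ = g z := Subtype.ext hyx.symm
    change g ⟨x, hx⟩ ∈ socle _
    rwa [this]

instance fittingStar_normal (G : Type*) [Group G] : (fittingStar G).Normal := by
  rw [fittingStar_eq]; infer_instance

theorem fitting_le_fittingStar (G : Type*) [Group G] : fitting G ≤ fittingStar G := by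
  rw [fittingStar_eq]
  conv_lhs => rw [← QuotientGroup.ker_mk' (fitting G)]
  exact ker_le_comap _ _

/-- Let D be the part of the preimage of B that centralizes F(G). Then D' ≤ F(G) is central in D or
at least centralized by it, so D is nilpotent and lies in F(G); and D covers B. -/
theorem eq_bot_of_le_centFittingQuot {G : Type*} [Group G] {B : Subgroup (G ⧸ fitting G)}
    (hB : B.Normal) (hBB : B ≤ centralizer B) (hBX : B ≤ centFittingQuot G) : B = ⊥ := by
  let f := QuotientGroup.mk' (fitting G)
  let D := B.comap f ⊓ centralizer (fitting G : Set G)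
  have h1 : ⁅D, D⁆ ≤ fitting G := by
    rw [← QuotientGroup.ker_mk' (fitting G), ← Subgroup.map_eq_bot_iff, map_commutator,
      commutator_eq_bot_iff_le_centralizer]
    have : D.map f ≤ B := map_le_iff_le_comap.2 inf_le_left
    exact (this.trans hBB).trans (centralizer_le this)
  have h2 : ⁅D, D⁆ ≤ centralizer D := h1.trans (le_centralizer_iff.1 inf_le_right)
  have h3 : D ≤ fitting G :=
    le_fitting inferInstance (isNilpotent_of_commutator_le_centralizer h2)
  refine le_bot_iff.1 fun b hb => ?_
  obtain ⟨c, hc, rfl⟩ := (centFittingQuot_eq G).le (hBX hb)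
  have : c ∈ f.ker := by
    rw [QuotientGroup.ker_mk']
    exact h3 ⟨hb, hc⟩
  exact this

theorem IsMinimalNormal.exists_fittingTilde_eq_top {G : Type*} [Group G] [Finite G]
    {M : Subgroup (centFittingQuot G)} (hM : IsMinimalNormal M) (hMc : ¬ M ≤ centralizer M) :
    ∃ E : Subgroup (centFitting G), E.Normal ∧ fittingTilde E = ⊤ ∧
      E.map ((QuotientGroup.mk' (fitting G)).subgroupMap (centFitting G)) = M := by
  let g : centFitting G →* centFittingQuot G :=
    (QuotientGroup.mk' (fitting G)).subgroupMap (centFitting G)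
  let C := (centralizer (fitting G : Set G)).subgroupOf (centFitting G)
  have := hM.1
  -- E is minimal among the normal subgroups inside C_G(F(G)) that map onto M. As M is perfect, E'
  -- also maps onto M, so E is perfect.
  obtain ⟨E, -, hE⟩ := (Set.toFinite {E : Subgroup (centFitting G) |
    E.Normal ∧ E ≤ C ∧ E.map g = M}).exists_le_minimal (a := M.comap g ⊓ C) <| by
      refine ⟨inferInstance, inf_le_right, le_antisymm (map_le_iff_le_comap.2 inf_le_left) ?_⟩
      intro x hx
      obtain ⟨c, hc, hcx⟩ := (centFittingQuot_eq G).le x.2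
      have hgc : g ⟨c, centralizer_le_centFitting G hc⟩ = x := Subtype.ext hcx
      exact ⟨⟨c, centralizer_le_centFitting G hc⟩,
        ⟨mem_comap.2 (hgc ▸ hx), hc⟩, hgc⟩
  obtain ⟨hEn, hEC, hEM⟩ := hE.prop
  refine ⟨E, hEn, ?_, hEM⟩
  have hperf : E ≤ ⁅E, E⁆ := hE.le_of_le
    ⟨inferInstance, (commutator_le_left E E).trans hEC, by
      rw [map_commutator, hEM, hM.commutator_eq hMc]⟩ (commutator_le_left E E)
  subst hEM
  have hr : Function.Surjective (g.subgroupMap E) := g.subgroupMap_surjective E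
  -- The kernel lies in F(G), which E centralizes, so it is contained in Z(E) ∩ E'.
  have hk : (g.subgroupMap E).ker ≤ frattini E := by
    intro x hx
    have hxF : ((x : centFitting G) : G) ∈ fitting G := by
      rw [← QuotientGroup.ker_mk' (fitting G)]
      have h1 : g.subgroupMap E x = 1 := MonoidHom.mem_ker.1 hx
      exact congrArg (fun y : E.map g => ((y : centFittingQuot G) : G ⧸ fitting G)) h1
    refine center_inf_commutator_le_frattini E ⟨mem_center_iff.2 fun y => ?_, ?_⟩
    · exact Subtype.ext <| Subtype.ext (mem_centralizer_iff.1 (hEC y.2) _ hxF).symm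
    · have := hperf x.2
      rw [← map_subtype_commutator] at this
      obtain ⟨y, hy, hyx⟩ := this
      rwa [← Subtype.ext hyx]
  rw [fittingTilde_eq_comap hr hk, ← top_le_iff]
  intro x _
  -- A minimal normal subgroup is its own socle.
  obtain ⟨y, hy, hyx⟩ := hM.le_map_socle le_rfl (g.subgroupMap E x).2
  have : y = g.subgroupMap E x := Subtype.ext hyx
  exact socle_le_fittingTilde _ (this ▸ hy)

theorem fittingStar_le_fittingTildeIter (G : Type*) [Group G] [Finite G] (n : ℕ) :
    fittingStar G ≤ fittingTildeIter G n := by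
  have key : (socle (centFittingQuot G)).map (centFittingQuot G).subtype ≤
      (fittingTildeIter G n).map (QuotientGroup.mk' (fitting G)) := by
    refine map_le_iff_le_comap.2 (sSup_le fun M hM => ?_)
    have hMc : ¬ M ≤ centralizer M := fun hMc => by
      obtain ⟨B, hB, hBB, hBX, hMB⟩ := IsMinimalNormal.exists_normal_le_centralizer hM hMc
      rw [eq_bot_of_le_centFittingQuot hB hBB hBX, le_bot_iff,
        map_eq_bot_iff_of_injective _ (subtype_injective _)] at hMB
      exact hM.2.1 hMB
    obtain ⟨E, hEn, hE, rfl⟩ := IsMinimalNormal.exists_fittingTilde_eq_top hM hMc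
    rintro _ ⟨x, hx, rfl⟩
    exact ⟨x, map_subtype_fittingTildeIter_le _ n ⟨x, le_fittingTildeIter hE n hx, rfl⟩, rfl⟩
  rw [fittingStar_eq]
  refine (comap_mono key).trans ?_
  rw [comap_map_eq, QuotientGroup.ker_mk']
  exact sup_le le_rfl (fitting_le_fittingTildeIter G n)

/-- Otherwise the image of C = C_G(F*(G)) in G/F(G) contains a minimal normal subgroup A, whose
preimage lies in F*(G). That preimage meets C in an abelian normal subgroup, which lies in F(G) yet
covers A. -/
theorem centralizer_fittingStar_le (G : Type*) [Group G] [Finite G] :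
    centralizer (fittingStar G : Set G) ≤ fitting G := by
  let f := QuotientGroup.mk' (fitting G)
  let C := centralizer (fittingStar G : Set G)
  have hCC : C ≤ centralizer (fitting G : Set G) := centralizer_le (fitting_le_fittingStar G)
  have hCX : C.map f ≤ centFittingQuot G := (Subgroup.map_mono hCC).trans (centFittingQuot_eq G).ge
  rw [← QuotientGroup.ker_mk' (fitting G), ← Subgroup.map_eq_bot_iff]
  by_contra hne
  obtain ⟨A, hA, hAC⟩ := exists_isMinimalNormal_le
    (Normal.map (H := C) inferInstance f (QuotientGroup.mk'_surjective _)) hne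
  have := hA.1
  have hAS : A.comap f ≤ fittingStar G := by
    rw [fittingStar_eq]
    exact comap_mono (hA.le_map_socle (hAC.trans hCX))
  have hB : A.comap f ⊓ C ≤ centralizer (A.comap f ⊓ C : Subgroup G) :=
    inf_le_right.trans (centralizer_le (inf_le_left.trans hAS))
  have hBF : A.comap f ⊓ C ≤ fitting G :=
    le_fitting inferInstance (isNilpotent_of_le_centralizer hB)
  refine hA.2.1 (le_bot_iff.1 fun a ha => ?_)
  obtain ⟨c, hc, rfl⟩ := hAC ha
  have : c ∈ f.ker := by
    rw [QuotientGroup.ker_mk']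
    exact hBF ⟨ha, hc⟩
  exact this

/-- A minimal normal subgroup not inside F(G) centralizes F(G), so it lies in the socle of
C_G(F(G))F(G). -/
theorem socle_le_fittingStar (G : Type*) [Group G] [Finite G] : socle G ≤ fittingStar G := by
  refine sSup_le fun L hL => ?_
  by_cases hLF : L ≤ fitting G
  · exact hLF.trans (fitting_le_fittingStar G)
  · have hLC : L ≤ centralizer (fitting G : Set G) :=
      le_centralizer_iff.1 (IsMinimalNormal.le_centralizer hL inferInstance hLF)
    refine (IsMinimalNormal.le_map_socle hL (hLC.trans le_sup_left)).trans
      (Subgroup.map_mono ?_)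
    exact map_le_iff_le_comap.1 (map_socle_le
      (QuotientGroup.mk'_surjective ((fitting G).subgroupOf (centFitting G))))

theorem map_socle_le_fittingStar {G : Type*} [Group G] [Finite G] {N : Subgroup G} [N.Normal]
    (hΦ : frattini N = ⊥) : (socle N).map N.subtype ≤ fittingStar G := by
  refine map_le_iff_le_comap.2 (sSup_le fun M hM => map_le_iff_le_comap.1 ?_)
  by_cases h : M ≤ centralizer M
  · obtain ⟨B, hB, hBB, -, hMB⟩ := IsMinimalNormal.exists_normal_le_centralizer hM h
    exact (hMB.trans (le_fitting hB (isNilpotent_of_le_centralizer hBB))).trans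
      (fitting_le_fittingStar G)
  · exact (IsMinimalNormal.map_le_socle hΦ hM h).trans (socle_le_fittingStar G)

theorem fittingTildeIter_succ_eq_fittingStar {G : Type*} [Group G] [Finite G] {n : ℕ}
    (h : frattiniOf (fittingTildeIter G n) = ⊥) : fittingTildeIter G (n + 1) = fittingStar G := by
  refine le_antisymm ?_ (fittingStar_le_fittingTildeIter G _)
  have hΦ : frattini (fittingTildeIter G n) = ⊥ :=
    (map_eq_bot_iff_of_injective _ (subtype_injective _)).1 h
  rw [fittingTildeIter, fittingTilde_eq_socle hΦ]
  exact map_socle_le_fittingStar hΦ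

/-! ### Direct products -/

/-- The projection G → N is surjective, hence respects the iterates, and it sends xy to x. -/
theorem IsInternalProduct.fittingTildeIter_le {G : Type*} [Group G] [Finite G] {N H : Subgroup G}
    [N.Normal] (h : IsInternalProduct ⊤ N H) {n : ℕ} {x y : G} (hx : x ∈ N) (hy : y ∈ H)
    (hxy : x * y ∈ fittingTildeIter G n) : x ∈ (fittingTildeIter N n).map N.subtype := by
  have hcomm : ∀ (a : N) (b : H), Commute (N.subtype a) (H.subtype b) :=
    fun a b => h.2.2 a a.2 b b.2
  let p : N × H →* G := MonoidHom.noncommCoprod N.subtype H.subtype hcomm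
  have hp : Function.Bijective p := by
    constructor
    · refine (MonoidHom.noncommCoprod_injective _ _ _).2 ⟨N.subtype_injective, H.subtype_injective, ?_⟩
      rw [range_subtype, range_subtype, disjoint_iff, h.2.1]
    · rw [← MonoidHom.range_eq_top, MonoidHom.noncommCoprod_range, range_subtype, range_subtype,
        h.1]
  let e : N × H ≃* G := MulEquiv.ofBijective p hp
  let q : G →* N := (MonoidHom.fst N H).comp e.symm.toMonoidHom
  have hq : q (x * y) = ⟨x, hx⟩ := by
    have : x * y = e (⟨x, hx⟩, ⟨y, hy⟩) := rfl
    simp [q, this]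
  have hqs : Function.Surjective q := Prod.fst_surjective.comp e.symm.surjective
  exact ⟨⟨x, hx⟩, hq ▸ map_fittingTildeIter_le_of_surjective n hqs ⟨_, hxy, rfl⟩, rfl⟩

theorem IsInternalProduct.fittingTildeIter {G : Type*} [Group G] [Finite G] {N H : Subgroup G}
    [N.Normal] [H.Normal] (h : IsInternalProduct ⊤ N H) (n : ℕ) :
    IsInternalProduct (fittingTildeIter G n) ((fittingTildeIter H n).map H.subtype)
      ((fittingTildeIter N n).map N.subtype) := by
  have h' : IsInternalProduct ⊤ H N :=
    ⟨by rw [sup_comm, h.1], by rw [inf_comm, h.2.1], fun a ha b hb => (h.2.2 b hb a ha).symm⟩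
  refine ⟨le_antisymm (sup_le (map_subtype_fittingTildeIter_le H n)
    (map_subtype_fittingTildeIter_le N n)) fun z hz => ?_, ?_, ?_⟩
  · obtain ⟨y, hy, x, hx, rfl⟩ := mem_sup_of_normal_left.1 (h'.1 ▸ mem_top z)
    refine mul_mem_sup (h'.fittingTildeIter_le hy hx hz) (h.fittingTildeIter_le hx hy ?_)
    rwa [(h.2.2 x hx y hy).eq]
  · exact le_bot_iff.1 (h'.2.1 ▸ inf_le_inf (map_subtype_le _) (map_subtype_le _))
  · exact fun a ha b hb => h'.2.2 a (map_subtype_le _ ha) b (map_subtype_le _ hb)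

end GenFitting

theorem proposition3p2 {G : Type*} [Group G] [Finite G] (n : ℕ) (N H : Subgroup G)
    [hN : N.Normal] [hH : H.Normal] :
    -- (1) compatibility with quotients by subgroups of the Frattini subgroup
    (1 ≤ n → N ≤ GenFitting.frattiniOf (GenFitting.fittingTildeIter G (n - 1)) →
      N ≤ GenFitting.fittingTildeIter G n ∧
      GenFitting.fittingTildeIter (G ⧸ N) n =
        (GenFitting.fittingTildeIter G n).map (QuotientGroup.mk' N)) ∧
    -- (2)
    GenFitting.fittingStar G ≤ GenFitting.fittingTildeIter G n ∧
    -- (3)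
    (1 ≤ n → GenFitting.frattiniOf (GenFitting.fittingTildeIter G (n - 1)) = ⊥ →
      GenFitting.fittingTildeIter G n = GenFitting.fittingStar G) ∧
    -- (4)
    Subgroup.centralizer (GenFitting.fittingTildeIter G n : Set G) ≤ GenFitting.fitting G ∧
    -- (5) monotonicity for normal subgroups
    (GenFitting.fittingTildeIter N n).map N.subtype ≤ GenFitting.fittingTildeIter G n ∧
    -- (6) monotonicity for quotients; the image of a subgroup `K` in `G / N` is `K N / N`
    (GenFitting.fittingTildeIter G n).map (QuotientGroup.mk' N) ≤
      GenFitting.fittingTildeIter (G ⧸ N) n ∧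
    -- (7) internal direct products
    (GenFitting.IsInternalProduct ⊤ N H →
      GenFitting.IsInternalProduct (GenFitting.fittingTildeIter G n)
        ((GenFitting.fittingTildeIter H n).map H.subtype)
        ((GenFitting.fittingTildeIter N n).map N.subtype)) := by
  refine ⟨fun hn hN => ?_, GenFitting.fittingStar_le_fittingTildeIter G n, fun hn h => ?_, ?_,
    GenFitting.map_subtype_fittingTildeIter_le N n,
    GenFitting.map_fittingTildeIter_le_of_surjective n (QuotientGroup.mk'_surjective N),
    fun h => h.fittingTildeIter n⟩
  · obtain ⟨n, rfl⟩ := Nat.exists_eq_add_of_le' hn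
    rw [Nat.add_sub_cancel] at hN
    refine ⟨hN.trans (GenFitting.frattiniOf_fittingTildeIter_le G n), ?_⟩
    rw [← QuotientGroup.ker_mk' N] at hN
    -- The hypothesis at level n gives equality at level n; the same hypothesis then carries it one
    -- level further.
    exact (GenFitting.map_fittingTildeIter_succ_eq
      (GenFitting.map_fittingTildeIter_eq (QuotientGroup.mk'_surjective N) n hN) hN).symm
  · obtain ⟨n, rfl⟩ := Nat.exists_eq_add_of_le' hn
    exact GenFitting.fittingTildeIter_succ_eq_fittingStar h
  · exact (Subgroup.centralizer_le (GenFitting.fittingStar_le_fittingTildeIter G n)).trans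
      (GenFitting.centralizer_fittingStar_le G)
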